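/- Let $N\ge 1$. A vector $\boldsymbol\alpha=(\alpha_1,\dots,\alpha_m)$ with $0<\alpha_i<1$ and $\sum_{i=1}^m\alpha_i^N<1$ is called a contraction vector. Denote by $\mathcal D(\boldsymbol\alpha)$ the collection of all dust-like self-similar sets in $\mathbb R^N$ with contraction vector $\boldsymbol\alpha$, that is, of all nonempty compact sets $E\subset\mathbb R^N$ for which there are orthogonal maps $R_i$ and vectors $t_i\in\mathbb R^N$ such that, with $f_i(x)=\alpha_iR_i(x+t_i)$, one has $E=\bigcup_{i=1}^m f_i(E)$ and the sets $f_i(E)$ are pairwise disjoint. Write $\mathcal D(\boldsymbol\alpha)\sim\mathcal D(\boldsymbol\beta)$ if some $E\in\mathcal D(\boldsymbol\alpha)$ and some $F\in\mathcal D(\boldsymbol\beta)$ are Lipschitz equivalent, i.e. there are a bijection $\phi:E\to F$ and a constant $C>0$ with $C^{-1}|x-y|\le|\phi(x)-\phi(y)|\le C|x-y|$ for all $x,y\in E$. Let $0<\lambda<1$ and let $a,b,c,d,e$ be positive integers such that $\boldsymbol\alpha=(\lambda^a,\lambda^b,\lambda^c)$ and $\boldsymbol\beta=(\lambda^d,\lambda^e)$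 are contraction vectors. Assume that no two of $a,b,c$ are equal to each other and strictly smaller than the third (this holds in particular if $a,b,c$ are distinct). Let $2^k$ be the largest power of $2$ dividing $\gcd(a,b,c)$, put $a'=a/2^k$, $b'=b/2^k$, $c'=c/2^k$, and $$\bar a=\gcd(a',b'-c'),\qquad \bar b=\gcd(b',a'-c'),\qquad \bar c=\gcd(c',a'-b').$$ Then $\mathcal D(\boldsymbol\alpha)\not\sim\mathcal D(\boldsymbol\beta)$, that is, no set in $\mathcal D(\boldsymbol\alpha)$ is Lipschitz equivalent to a set in $\mathcal D(\boldsymbol\beta)$, if at least one of the following conditions holds: (1) $a,b,c$ are all odd; (2) $a'\not\equiv 0 \pmod{2\bar a}$, $b'\not\equiv 0\pmod{2\bar b}$ and $c'\not\equiv 0\pmod{2\bar c}$. -/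

import Mathlib

/-- Two subsets of Euclidean space are Lipschitz equivalent: there is a bi-Lipschitz
bijection from `E` onto `F`. -/
def LipschitzEquivalent {N : ℕ} (E F : Set (EuclideanSpace ℝ (Fin N))) : Prop :=
  ∃ φ : E → F, Function.Bijective φ ∧ ∃ C : ℝ, 0 < C ∧
    ∀ x y : E, C⁻¹ * dist x y ≤ dist (φ x) (φ y) ∧ dist (φ x) (φ y) ≤ C * dist x y

/-- `α = (α₁, …, αₘ)` is a contraction vector (for the ambient space `ℝ^N`). -/
def IsContractionVector (N : ℕ) {m : ℕ} (α : Fin m → ℝ) : Prop :=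
  (∀ i, 0 < α i ∧ α i < 1) ∧ ∑ i, α i ^ N < 1

/-- The similarity `x ↦ r R(x + t)` with `R` orthogonal. -/
noncomputable def similarityMap {N : ℕ} (r : ℝ)
    (R : EuclideanSpace ℝ (Fin N) ≃ₗᵢ[ℝ] EuclideanSpace ℝ (Fin N))
    (t x : EuclideanSpace ℝ (Fin N)) : EuclideanSpace ℝ (Fin N) :=
  r • R (x + t)

/-- `D(α)`: all dust-like self-similar sets in `ℝ^N` with contraction vector `α`, that is, all
nonempty compact `E` which are the disjoint union of the `fᵢ(E)` for some iterated function system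
`fᵢ(x) = αᵢ Rᵢ(x + tᵢ)`. -/
def dustLikeSets (N : ℕ) {m : ℕ} (α : Fin m → ℝ) : Set (Set (EuclideanSpace ℝ (Fin N))) :=
  {E | E.Nonempty ∧ IsCompact E ∧
    ∃ (R : Fin m → (EuclideanSpace ℝ (Fin N) ≃ₗᵢ[ℝ] EuclideanSpace ℝ (Fin N)))
      (t : Fin m → EuclideanSpace ℝ (Fin N)),
      E = ⋃ i, similarityMap (α i) (R i) (t i) '' E ∧
      ∀ i j, i ≠ j →
        Disjoint (similarityMap (α i) (R i) (t i) '' E) (similarityMap (α j) (R j) (t j) '' E)}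

/-- `D(α) ∼ D(β)`: some member of `D(α)` is Lipschitz equivalent to some member of `D(β)`. -/
def DustEquivalent (N : ℕ) {m n : ℕ} (α : Fin m → ℝ) (β : Fin n → ℝ) : Prop :=
  ∃ E ∈ dustLikeSets N α, ∃ F ∈ dustLikeSets N β, LipschitzEquivalent E F

/-- The largest power of `2` dividing `gcd(a, b, c)`. -/
def twoPart (a b c : ℕ) : ℕ := 2 ^ padicValNat 2 (Nat.gcd a (Nat.gcd b c))

/-- With `x' = x / 2^k`, where `2^k` is the largest power of `2` dividing `gcd(a, b, c)`:
`a' ≢ 0 (mod 2 gcd(a', b' - c'))`, and likewise for the other two exponents. -/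
def ArithmeticCondition (a b c : ℕ) : Prop :=
  let a' : ℕ := a / twoPart a b c
  let b' : ℕ := b / twoPart a b c
  let c' : ℕ := c / twoPart a b c
  let aBar : ℕ := Int.gcd (a' : ℤ) ((b' : ℤ) - (c' : ℤ))
  let bBar : ℕ := Int.gcd (b' : ℤ) ((a' : ℤ) - (c' : ℤ))
  let cBar : ℕ := Int.gcd (c' : ℤ) ((a' : ℤ) - (b' : ℤ))
  ¬ a' ≡ 0 [MOD 2 * aBar] ∧ ¬ b' ≡ 0 [MOD 2 * bBar] ∧ ¬ c' ≡ 0 [MOD 2 * cBar]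

/-! A bi-Lipschitz map preserves, up to constants, how many points of a set can be pairwise
`λ^n`-apart. For a dust-like set with ratios `λ^(p i)` this number grows like `x^(-n)`, where `x` in
`(0, 1)` solves `∑ x^(p i) = 1` (so `x = λ^s` with `s` the dimension). Equivalence therefore forces
a common root `x` of `x^a + x^b + x^c = 1` and `x^d + x^e = 1`, and the rest is arithmetic of
integer polynomials.

Either arithmetic condition excludes every `z` with `z^a = 1`, `z^b + z^c = 0` and its permutations
(`NoUnitRoot`). If `a > b > c`, the polynomial `f = X^a + X^b + X^c - 1` is then irreducible by
Ljunggren's method: `f` is coprime to its mirror, and `f * f.mirror = k * k.mirror` only for `k =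
±f` or `k = ±f.mirror`. If the two largest exponents are equal, the reciprocal polynomial `X^a -
X^(a-c) - 2` takes over: its roots avoid the open unit disc and its constant term is prime up to
sign, so a proper factorization would put a factor's roots on the unit circle.

In both cases the trinomial equation's polynomial must divide that of the binomial equation, which
fails at `1`: the values are `±2` and `±1`. -/

/-! ### Growth of separated subsets of dust-like sets -/

/-- Any two distinct points of the finite set `t` have distance at least `r`. -/
def SeparatedBy {X : Type*} [MetricSpace X] (r : ℝ) (t : Finset X) : Prop :=
  ∀ u ∈ t, ∀ v ∈ t, u ≠ v → r ≤ dist u v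

theorem IsCompact.exists_card_le_of_separatedBy {X : Type*} [MetricSpace X] {E : Set X}
    (hE : IsCompact E) {r : ℝ} (hr : 0 < r) :
    ∃ K : ℕ, ∀ t : Finset X, ↑t ⊆ E → SeparatedBy r t → t.card ≤ K := by
  obtain ⟨s, -, hs, hcov⟩ := hE.finite_cover_balls (half_pos hr)
  refine ⟨hs.toFinset.card, fun t htE hsep => ?_⟩
  by_contra! hlt
  have hc : ∀ u ∈ t, ∃ c ∈ hs.toFinset, u ∈ Metric.ball c (r / 2) := by
    intro u hu
    simpa using hcov (htE hu)
  choose! c hcs hcb using hc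
  obtain ⟨u, hu, v, hv, huv, hcc⟩ := Finset.exists_ne_map_eq_of_card_lt_of_maps_to hlt hcs
  have h1 := Metric.mem_ball.1 (hcb u hu)
  have h2 := Metric.mem_ball'.1 (hcb v hv)
  rw [hcc] at h1
  have := hsep u hu v hv huv
  linarith [dist_triangle u (c v) v]

theorem dist_similarityMap {N : ℕ} {r : ℝ} (hr : 0 ≤ r)
    (R : EuclideanSpace ℝ (Fin N) ≃ₗᵢ[ℝ] EuclideanSpace ℝ (Fin N))
    (t x y : EuclideanSpace ℝ (Fin N)) :
    dist (similarityMap r R t x) (similarityMap r R t y) = r * dist x y := by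
  simp [similarityMap, dist_smul₀, abs_of_nonneg hr]

theorem similarityMap_injective {N : ℕ} {r : ℝ} (hr : 0 < r)
    (R : EuclideanSpace ℝ (Fin N) ≃ₗᵢ[ℝ] EuclideanSpace ℝ (Fin N))
    (t : EuclideanSpace ℝ (Fin N)) : Function.Injective (similarityMap r R t) := by
  intro x y h
  have := dist_similarityMap hr.le R t x y
  rw [h, dist_self, eq_comm, mul_eq_zero, dist_eq_zero] at this
  exact this.resolve_left hr.ne'

/-- Pulling a `ρλ^n`-separated set back through the `i`-th similarity gives a `ρλ^(n - p
i)`-separated set. Since `∑ x^(p i) = 1`, the recursion reproduces the same constant. -/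
theorem card_separatedBy_mul_pow_le {N m : ℕ} {lam : ℝ} (hlam0 : 0 < lam) (hlam1 : lam < 1)
    {p : Fin m → ℕ} (hp : ∀ i, 0 < p i) {E : Set (EuclideanSpace ℝ (Fin N))}
    (hE : E ∈ dustLikeSets N (fun i => lam ^ p i)) {x : ℝ} (hx0 : 0 < x) (hx1 : x < 1)
    (hx : ∑ i, x ^ p i = 1) {ρ : ℝ} (hρ : 0 < ρ) :
    ∃ K : ℝ, 0 < K ∧ ∀ n : ℕ, ∀ t : Finset (EuclideanSpace ℝ (Fin N)), ↑t ⊆ E →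
      SeparatedBy (ρ * lam ^ n) t → t.card * x ^ n ≤ K := by
  classical
  obtain ⟨-, hcomp, R, s, hunion, -⟩ := hE
  set A := ∑ i, p i with hA
  have hpA : ∀ i, p i ≤ A := fun i => Finset.single_le_sum (fun _ _ => Nat.zero_le _)
    (Finset.mem_univ i)
  obtain ⟨K, hK⟩ := hcomp.exists_card_le_of_separatedBy (mul_pos hρ (pow_pos hlam0 A))
  refine ⟨K + 1, by positivity, fun n => ?_⟩
  induction n using Nat.strong_induction_on with
  | _ n ih =>
    intro t htE hsep
    -- Above `A` every `n - p i` is a genuine subtraction; up to `A` compactness gives one uniform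
    -- bound.
    rcases le_or_gt n A with hn | hn
    · have h1 : t.card ≤ K := hK t htE fun u hu v hv huv =>
        (mul_le_mul_of_nonneg_left (pow_le_pow_of_le_one hlam0.le hlam1.le hn) hρ.le).trans
          (hsep u hu v hv huv)
      have h2 : x ^ n ≤ 1 := pow_le_one₀ hx0.le hx1.le
      have h3 : (t.card : ℝ) ≤ K := by exact_mod_cast h1
      have h4 : (t.card : ℝ) * x ^ n ≤ t.card * 1 :=
        mul_le_mul_of_nonneg_left h2 (Nat.cast_nonneg _)
      linarith
    · set f := fun i => similarityMap (lam ^ p i) (R i) (s i) with hf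
      have hinj : ∀ i, Function.Injective (f i) := fun i =>
        similarityMap_injective (pow_pos hlam0 _) _ _
      set T := fun i => (t.preimage (f i) (hinj i).injOn).filter (· ∈ E) with hT
      have hcard : t.card ≤ ∑ i, (T i).card := by
        have hsub : t ⊆ Finset.univ.biUnion fun i => (T i).image (f i) := by
          intro u hu
          have huE := htE hu
          rw [hunion] at huE
          obtain ⟨i, v, hv, rfl⟩ := Set.mem_iUnion.1 huE
          simp only [Finset.mem_biUnion, Finset.mem_univ, true_and, Finset.mem_image]
          exact ⟨i, v, Finset.mem_filter.2 ⟨Finset.mem_preimage.2 hu, hv⟩, rfl⟩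
        exact (Finset.card_le_card hsub).trans (Finset.card_biUnion_le.trans
          (Finset.sum_le_sum fun i _ => Finset.card_image_le))
      have hstep : ∀ i, ((T i).card : ℝ) * x ^ n ≤ (K + 1) * x ^ p i := by
        intro i
        have hpn : p i ≤ n := (hpA i).trans hn.le
        have hlt : n - p i < n := Nat.sub_lt (by omega) (hp i)
        have h := ih (n - p i) hlt (T i) (fun u hu => (Finset.mem_filter.1 (Finset.mem_coe.1 hu)).2) ?_
        · calc ((T i).card : ℝ) * x ^ n = (T i).card * x ^ (n - p i) * x ^ p i := by
                rw [mul_assoc, ← pow_add, Nat.sub_add_cancel hpn]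
            _ ≤ _ := by gcongr
        · intro u hu v hv huv
          simp only [hT, Finset.mem_filter, Finset.mem_preimage] at hu hv
          have h := hsep _ hu.1 _ hv.1 ((hinj i).ne huv)
          rw [hf, dist_similarityMap (pow_pos hlam0 _).le] at h
          have e : ρ * lam ^ n = lam ^ p i * (ρ * lam ^ (n - p i)) := by
            rw [mul_left_comm, ← pow_add, Nat.add_sub_cancel' hpn]
          rw [e] at h
          exact le_of_mul_le_mul_left h (pow_pos hlam0 _)
      calc (t.card : ℝ) * x ^ n ≤ (∑ i, ((T i).card : ℝ)) * x ^ n := by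
            gcongr; exact_mod_cast hcard
        _ = ∑ i, ((T i).card : ℝ) * x ^ n := Finset.sum_mul _ _ _
        _ ≤ ∑ i, (K + 1 : ℝ) * x ^ p i := Finset.sum_le_sum fun i _ => hstep i
        _ = K + 1 := by rw [← Finset.mul_sum, hx, mul_one]

theorem exists_pos_forall_le_dist {X ι : Type*} [MetricSpace X] [Finite ι] {S : ι → Set X}
    (hS : ∀ i, IsCompact (S i)) (hdisj : ∀ i j, i ≠ j → Disjoint (S i) (S j)) :
    ∃ ρ : ℝ, 0 < ρ ∧ ∀ i j, i ≠ j → ∀ u ∈ S i, ∀ v ∈ S j, ρ ≤ dist u v := by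
  have h : ∀ᶠ ρ : ℝ in nhdsWithin 0 (Set.Ioi 0),
      ∀ i j, i ≠ j → ∀ u ∈ S i, ∀ v ∈ S j, ρ ≤ dist u v := by
    rw [Filter.eventually_all]
    intro i
    rw [Filter.eventually_all]
    intro j
    by_cases hij : i = j
    · simp [hij]
    obtain ⟨r, hr, hd⟩ := Metric.exists_pos_forall_lt_edist (hS i) (hS j).isClosed (hdisj i j hij)
    filter_upwards [Ioo_mem_nhdsGT (show (0 : ℝ) < r from hr)] with ρ hρ _ u hu v hv
    have := hd u hu v hv
    rw [edist_nndist, ENNReal.coe_lt_coe] at this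
    exact hρ.2.le.trans (NNReal.coe_lt_coe.2 this).le
  obtain ⟨ρ, h1, h2⟩ := (h.and self_mem_nhdsWithin).exists
  exact ⟨ρ, h2, h1⟩

/-- Separated sets at coarser scales are transported into the pieces and united. Here `ρ` is the gap
between distinct pieces, so points in different pieces are far enough apart at every scale. -/
theorem exists_separatedBy_le_card_mul_pow {N m : ℕ} {lam : ℝ} (hlam0 : 0 < lam)
    (hlam1 : lam < 1) {p : Fin m → ℕ} (hp : ∀ i, 0 < p i) {E : Set (EuclideanSpace ℝ (Fin N))}
    (hE : E ∈ dustLikeSets N (fun i => lam ^ p i)) {x : ℝ} (hx0 : 0 < x) (hx1 : x < 1)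
    (hx : ∑ i, x ^ p i = 1) :
    ∃ ρ k : ℝ, 0 < ρ ∧ 0 < k ∧ ∀ n : ℕ, ∃ t : Finset (EuclideanSpace ℝ (Fin N)), ↑t ⊆ E ∧
      SeparatedBy (ρ * lam ^ n) t ∧ k ≤ t.card * x ^ n := by
  classical
  obtain ⟨⟨z, hz⟩, hcomp, R, s, hunion, hdisj⟩ := hE
  set A := ∑ i, p i with hA
  have hpA : ∀ i, p i ≤ A := fun i => Finset.single_le_sum (fun _ _ => Nat.zero_le _)
    (Finset.mem_univ i)
  set f := fun i => similarityMap (lam ^ p i) (R i) (s i) with hf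
  have hdist : ∀ i u v, dist (f i u) (f i v) = lam ^ p i * dist u v := fun i u v =>
    dist_similarityMap (pow_pos hlam0 _).le _ _ _ _
  have hinj : ∀ i, Function.Injective (f i) := fun i =>
    similarityMap_injective (pow_pos hlam0 _) _ _
  have hcont : ∀ i, Continuous (f i) := fun i =>
    (LipschitzWith.of_dist_le_mul (K := ⟨lam ^ p i, (pow_pos hlam0 _).le⟩)
      fun u v => (hdist i u v).le).continuous
  obtain ⟨ρ, hρ, hgap⟩ := exists_pos_forall_le_dist (S := fun i => f i '' E)
    (fun i => hcomp.image (hcont i)) hdisj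
  refine ⟨ρ, x ^ A, hρ, pow_pos hx0 A, fun n => ?_⟩
  induction n using Nat.strong_induction_on with
  | _ n ih =>
    rcases le_or_gt n A with hn | hn
    -- One point suffices for small `n`, which is why the constant is `x ^ A`.
    · refine ⟨{z}, by simpa using hz, by simp [SeparatedBy], ?_⟩
      simpa using pow_le_pow_of_le_one hx0.le hx1.le hn
    · have hpn : ∀ i, p i ≤ n := fun i => (hpA i).trans hn.le
      choose T hTE hTsep hTcard using fun i =>
        ih (n - p i) (Nat.sub_lt (by omega) (hp i))
      have hmem : ∀ i, ∀ u ∈ (T i).image (f i), u ∈ f i '' E := by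
        intro i u hu
        obtain ⟨v, hv, rfl⟩ := Finset.mem_image.1 hu
        exact ⟨v, hTE i hv, rfl⟩
      refine ⟨Finset.univ.biUnion fun i => (T i).image (f i), ?_, ?_, ?_⟩
      · intro u hu
        obtain ⟨i, -, hi⟩ := Finset.mem_biUnion.1 (Finset.mem_coe.1 hu)
        rw [hunion]
        exact Set.mem_iUnion.2 ⟨i, hmem i u hi⟩
      · intro u hu v hv huv
        obtain ⟨i, -, hi⟩ := Finset.mem_biUnion.1 hu
        obtain ⟨j, -, hj⟩ := Finset.mem_biUnion.1 hv
        by_cases hij : i = j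
        · subst hij
          obtain ⟨u', hu', rfl⟩ := Finset.mem_image.1 hi
          obtain ⟨v', hv', rfl⟩ := Finset.mem_image.1 hj
          have h := hTsep i u' hu' v' hv' fun h => huv (h ▸ rfl)
          have e : ρ * lam ^ n = lam ^ p i * (ρ * lam ^ (n - p i)) := by
            rw [mul_left_comm, ← pow_add, Nat.add_sub_cancel' (hpn i)]
          rw [hdist, e]
          gcongr
        · refine le_trans ?_ (hgap i j hij u (hmem i u hi) v (hmem j v hj))
          exact mul_le_of_le_one_right hρ.le (pow_le_one₀ hlam0.le hlam1.le)
      · rw [Finset.card_biUnion]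
        · push_cast
          rw [Finset.sum_mul]
          calc x ^ A = ∑ i, x ^ A * x ^ p i := by rw [← Finset.mul_sum, hx, mul_one]
            _ ≤ _ := Finset.sum_le_sum fun i _ => ?_
          rw [Finset.card_image_of_injective _ (hinj i), ← Nat.sub_add_cancel (hpn i), pow_add,
            ← mul_assoc]
          exact mul_le_mul_of_nonneg_right (hTcard i) (pow_pos hx0 _).le
        · intro i _ j _ hij
          exact Finset.disjoint_left.2 fun u hi hj => Set.disjoint_left.1 (hdisj i j hij) (hmem i u hi) (hmem j u hj)

/-- A Lipschitz embedding cannot decrease the growth rate of separated sets. -/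
theorem root_le_of_dist_le {N m n : ℕ} {lam : ℝ} (hlam0 : 0 < lam) (hlam1 : lam < 1)
    {p : Fin m → ℕ} (hp : ∀ i, 0 < p i) {q : Fin n → ℕ} (hq : ∀ i, 0 < q i)
    {E F : Set (EuclideanSpace ℝ (Fin N))}
    (hE : E ∈ dustLikeSets N (fun i => lam ^ p i)) (hF : F ∈ dustLikeSets N (fun i => lam ^ q i))
    {x y : ℝ} (hx0 : 0 < x) (hx1 : x < 1) (hx : ∑ i, x ^ p i = 1)
    (hy0 : 0 < y) (hy1 : y < 1) (hy : ∑ i, y ^ q i = 1)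
    {φ : E → F} {C : ℝ} (hC : 0 < C) (hφ : ∀ u v, C * dist u v ≤ dist (φ u) (φ v)) :
    y ≤ x := by
  classical
  obtain ⟨ρ, k, hρ, hk, hlow⟩ :=
    exists_separatedBy_le_card_mul_pow hlam0 hlam1 hp hE hx0 hx1 hx
  obtain ⟨K, hK, hup⟩ :=
    card_separatedBy_mul_pow_le hlam0 hlam1 hq hF hy0 hy1 hy (mul_pos hC hρ)
  by_contra! hlt
  have h1 : 1 < y / x := (one_lt_div hx0).2 hlt
  -- The two counts give `k * x^(-j) ≤ K * y^(-j)`, hence `(y/x)^j ≤ K/k`, for every `j`.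
  obtain ⟨j, hj⟩ := pow_unbounded_of_one_lt (K / k) h1
  obtain ⟨t, htE, hsep, hcard⟩ := hlow j
  have hφinj : Function.Injective φ := by
    intro u v h
    have := hφ u v
    rw [h, dist_self] at this
    exact dist_le_zero.1 (nonpos_of_mul_nonpos_right this hC)
  set g : E → EuclideanSpace ℝ (Fin N) := fun u => (φ u : EuclideanSpace ℝ (Fin N)) with hg
  have hginj : Function.Injective g := Subtype.val_injective.comp hφinj
  have h := hup j ((t.subtype (· ∈ E)).image g) ?_ ?_
  · rw [Finset.card_image_of_injective _ hginj, Finset.card_subtype,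
      Finset.filter_true_of_mem (fun u hu => htE hu)] at h
    have hxj := pow_pos hx0 j
    rw [div_pow, div_lt_div_iff₀ hk hxj] at hj
    have hyj := pow_pos hy0 j
    nlinarith [mul_le_mul_of_nonneg_right h hxj.le, mul_le_mul_of_nonneg_right hcard hyj.le]
  · intro u hu
    obtain ⟨v, -, rfl⟩ := Finset.mem_image.1 (Finset.mem_coe.1 hu)
    exact (φ v).2
  · intro u hu v hv huv
    obtain ⟨u', hu', rfl⟩ := Finset.mem_image.1 hu
    obtain ⟨v', hv', rfl⟩ := Finset.mem_image.1 hv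
    have h1 := hsep u' (Finset.mem_subtype.1 hu') v' (Finset.mem_subtype.1 hv')
      fun h => huv (by rw [Subtype.ext h])
    calc C * ρ * lam ^ j = C * (ρ * lam ^ j) := mul_assoc _ _ _
      _ ≤ C * dist u' v' := by gcongr; exact h1
      _ ≤ _ := hφ u' v'

theorem root_eq_of_lipschitzEquivalent {N m n : ℕ} {lam : ℝ} (hlam0 : 0 < lam) (hlam1 : lam < 1)
    {p : Fin m → ℕ} (hp : ∀ i, 0 < p i) {q : Fin n → ℕ} (hq : ∀ i, 0 < q i)
    {E F : Set (EuclideanSpace ℝ (Fin N))}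
    (hE : E ∈ dustLikeSets N (fun i => lam ^ p i)) (hF : F ∈ dustLikeSets N (fun i => lam ^ q i))
    (hEF : LipschitzEquivalent E F)
    {x y : ℝ} (hx0 : 0 < x) (hx1 : x < 1) (hx : ∑ i, x ^ p i = 1)
    (hy0 : 0 < y) (hy1 : y < 1) (hy : ∑ i, y ^ q i = 1) : x = y := by
  obtain ⟨φ, hφ, C, hC, h⟩ := hEF
  refine le_antisymm ?_ (root_le_of_dist_le hlam0 hlam1 hp hq hE hF hx0 hx1 hx hy0 hy1 hy
    (inv_pos.2 hC) fun u v => (h u v).1)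
  set ψ := Equiv.ofBijective φ hφ
  refine root_le_of_dist_le hlam0 hlam1 hq hp hF hE hy0 hy1 hy hx0 hx1 hx
    (φ := ψ.symm) (inv_pos.2 hC) fun u v => ?_
  have := (h (ψ.symm u) (ψ.symm v)).2
  rw [show φ (ψ.symm u) = u from ψ.apply_symm_apply u,
    show φ (ψ.symm v) = v from ψ.apply_symm_apply v] at this
  rwa [inv_mul_le_iff₀ hC]

theorem exists_root_sum_pow {m : ℕ} (hm : 2 ≤ m) {p : Fin m → ℕ} (hp : ∀ i, 0 < p i) :
    ∃ x : ℝ, 0 < x ∧ x < 1 ∧ ∑ i, x ^ p i = 1 := by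
  have hcont : ContinuousOn (fun x : ℝ => ∑ i, x ^ p i) (Set.Icc 0 1) := by fun_prop
  have h0 : ∑ i, (0 : ℝ) ^ p i = 0 := Finset.sum_eq_zero fun i _ => zero_pow (hp i).ne'
  have h1 : ∑ i, (1 : ℝ) ^ p i = m := by simp
  have hm' : (1 : ℝ) < m := by exact_mod_cast hm
  obtain ⟨x, hx, hxe⟩ := intermediate_value_Icc zero_le_one hcont
    (show (1 : ℝ) ∈ _ from ⟨by simp only [h0]; norm_num, by simp only [h1]; exact hm'.le⟩)
  refine ⟨x, lt_of_le_of_ne hx.1 ?_, lt_of_le_of_ne hx.2 ?_, hxe⟩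
  · rintro rfl
    simp only [h0] at hxe
    norm_num at hxe
  · rintro rfl
    simp only [h1] at hxe
    linarith

/-! ### Roots of unity and the arithmetic conditions -/

section Polynomial

open Polynomial

/-- No root of unity `z` satisfies `z ^ a = 1` and `z ^ b + z ^ c = 0`, nor any of the conditions
obtained from this one by permuting the exponents. -/
def NoUnitRoot (a b c : ℕ) : Prop :=
  ∀ z : ℂ, ¬ (z ^ a = 1 ∧ z ^ b + z ^ c = 0) ∧ ¬ (z ^ b = 1 ∧ z ^ a + z ^ c = 0) ∧
    ¬ (z ^ c = 1 ∧ z ^ a + z ^ b = 0)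

theorem NoUnitRoot.swap_left {a b c : ℕ} (h : NoUnitRoot a b c) : NoUnitRoot b a c :=
  fun z => ⟨(h z).2.1, (h z).1, by rw [add_comm]; exact (h z).2.2⟩

theorem NoUnitRoot.swap_right {a b c : ℕ} (h : NoUnitRoot a b c) : NoUnitRoot a c b :=
  fun z => ⟨by rw [add_comm]; exact (h z).1, (h z).2.2, (h z).2.1⟩

/-- By Bézout, `z^a = 1` and `z^(b-c) = -1` give `z^g = ±1` for the gcd `g`. Were `a / g` odd, `z^a
= 1` would force `z^g = 1`, contradicting `z^(b-c) = -1`. -/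
theorem modEq_zero_of_pow_eq_one {a b c : ℕ} (ha : 0 < a) {z : ℂ} (h1 : z ^ a = 1)
    (h2 : z ^ b + z ^ c = 0) : a ≡ 0 [MOD 2 * Int.gcd (a : ℤ) ((b : ℤ) - (c : ℤ))] := by
  have hz : z ≠ 0 := by
    rintro rfl
    rw [zero_pow ha.ne'] at h1
    exact zero_ne_one h1
  set g := Int.gcd (a : ℤ) ((b : ℤ) - (c : ℤ)) with hg
  have hbc : z ^ ((b : ℤ) - c) = -1 := by
    rw [zpow_sub₀ hz, zpow_natCast, zpow_natCast, eq_neg_of_add_eq_zero_left h2, neg_div,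
      div_self (pow_ne_zero _ hz)]
  have hza : z ^ (a : ℤ) = 1 := by rw [zpow_natCast, h1]
  have hgz : (z ^ g) ^ 2 = 1 := by
    have hb := Int.gcd_eq_gcd_ab (a : ℤ) ((b : ℤ) - (c : ℤ))
    rw [← zpow_natCast z g, hg, hb, zpow_add₀ hz, zpow_mul, zpow_mul, hza, hbc, one_zpow, one_mul,
      ← zpow_natCast, ← zpow_mul, mul_comm, zpow_mul]
    norm_num
  obtain ⟨j, hj⟩ : (g : ℤ) ∣ (b : ℤ) - c := Int.gcd_dvd_right _ _
  obtain ⟨i, hi⟩ : g ∣ a := Int.natCast_dvd_natCast.1 (Int.gcd_dvd_left _ _)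
  rcases Nat.even_or_odd' i with ⟨l, rfl | rfl⟩
  · rw [Nat.modEq_zero_iff_dvd, hi]
    exact ⟨l, by ring⟩
  · exfalso
    have h3 : z ^ g = 1 := by
      rw [hi, pow_mul, pow_add, pow_mul, hgz, one_pow, one_mul, pow_one] at h1
      exact h1
    rw [hj, zpow_mul, zpow_natCast, h3, one_zpow] at hbc
    norm_num at hbc

theorem noUnitRoot_of_odd {a b c : ℕ} (ha : Odd a) (hb : Odd b) (hc : Odd c) :
    NoUnitRoot a b c := by
  have key : ∀ {u v w : ℕ}, Odd u → ∀ z : ℂ, ¬ (z ^ u = 1 ∧ z ^ v + z ^ w = 0) := by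
    rintro u v w hu z ⟨h1, h2⟩
    have h := (Nat.modEq_zero_iff_dvd.1 (modEq_zero_of_pow_eq_one hu.pos h1 h2))
    exact (Nat.not_even_iff_odd.2 hu) (even_iff_two_dvd.2 ((Dvd.intro _ rfl).trans h))
  exact fun z => ⟨key ha z, key hb z, key hc z⟩

/-- A forbidden `z` for `a, b, c` yields the forbidden `z^(2^k)` for `a', b', c'`. -/
theorem noUnitRoot_of_arithmeticCondition {a b c : ℕ} (ha : 0 < a) (hb : 0 < b) (hc : 0 < c)
    (h : ArithmeticCondition a b c) : NoUnitRoot a b c := by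
  obtain ⟨h1, h2, h3⟩ := h
  have hd : twoPart a b c ∣ Nat.gcd a (Nat.gcd b c) := pow_padicValNat_dvd
  have hda : twoPart a b c ∣ a := hd.trans (Nat.gcd_dvd_left _ _)
  have hdb : twoPart a b c ∣ b :=
    hd.trans ((Nat.gcd_dvd_right _ _).trans (Nat.gcd_dvd_left _ _))
  have hdc : twoPart a b c ∣ c :=
    hd.trans ((Nat.gcd_dvd_right _ _).trans (Nat.gcd_dvd_right _ _))
  have key : ∀ (z : ℂ) {u : ℕ}, twoPart a b c ∣ u →
      z ^ u = (z ^ twoPart a b c) ^ (u / twoPart a b c) := by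
    intro z u hu
    rw [← pow_mul, Nat.mul_div_cancel' hu]
  intro z
  rw [key z hda, key z hdb, key z hdc]
  exact ⟨fun h => h1 (modEq_zero_of_pow_eq_one (Nat.div_pos (Nat.le_of_dvd ha hda)
      (by unfold twoPart; positivity)) h.1 h.2),
    fun h => h2 (modEq_zero_of_pow_eq_one (Nat.div_pos (Nat.le_of_dvd hb hdb)
      (by unfold twoPart; positivity)) h.1 h.2),
    fun h => h3 (modEq_zero_of_pow_eq_one (Nat.div_pos (Nat.le_of_dvd hc hdc)
      (by unfold twoPart; positivity)) h.1 h.2)⟩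

/-! ### Two equal largest exponents -/

/-- A monic integer polynomial with constant term `±1` all of whose complex roots lie outside the
open unit disc has all its roots on the unit circle. -/
theorem norm_eq_one_of_mem_roots {Q : ℤ[X]} (hQ : Q.Monic) (h0 : IsUnit (Q.coeff 0))
    (hroots : ∀ z : ℂ, aeval z Q = 0 → 1 ≤ ‖z‖) {z : ℂ} (hz : aeval z Q = 0) : ‖z‖ = 1 := by
  set P : ℂ[X] := Q.map (Int.castRingHom ℂ) with hP
  have hPm : P.Monic := hQ.map _
  have hmem : ∀ w, w ∈ P.roots ↔ aeval w Q = 0 := by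
    intro w
    rw [mem_roots hPm.ne_zero, IsRoot.def, hP, eval_map, aeval_def]
    rfl
  have hprod : (P.roots.map fun w => ‖w‖).prod = 1 := by
    have h := (IsAlgClosed.splits P).coeff_zero_eq_prod_roots_of_monic hPm
    have h2 : ‖P.coeff 0‖ = 1 := by
      rw [hP, coeff_map]
      rcases Int.isUnit_iff.1 h0 with h | h <;> simp [h]
    rw [h, norm_mul, norm_pow, norm_neg, norm_one, one_pow, one_mul] at h2
    rw [← h2]
    exact (map_multiset_prod (normHom : ℂ →*₀ ℝ) P.roots).symm
  refine le_antisymm ?_ (hroots z hz)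
  obtain ⟨s, hs⟩ := Multiset.exists_cons_of_mem ((hmem z).2 hz)
  rw [hs, Multiset.map_cons, Multiset.prod_cons] at hprod
  have h1 : 1 ≤ (s.map fun w => ‖w‖).prod := by
    refine Multiset.one_le_prod ?_
    intro r hr
    obtain ⟨w, hw, rfl⟩ := Multiset.mem_map.1 hr
    exact hroots w ((hmem w).1 (hs ▸ Multiset.mem_cons_of_mem hw))
  have := norm_nonneg z
  nlinarith

theorem exists_complex_root {Q : ℤ[X]} (hQ : Q.Monic) (h : Q ≠ 1) : ∃ z : ℂ, aeval z Q = 0 := by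
  have hPm : (Q.map (Int.castRingHom ℂ)).Monic := hQ.map _
  obtain ⟨z, hz⟩ := IsAlgClosed.exists_root (Q.map (Int.castRingHom ℂ)) (by
    rw [hQ.degree_map]
    exact fun h0 => h (hQ.natDegree_eq_zero.1 (natDegree_eq_of_degree_eq_some h0)))
  refine ⟨z, ?_⟩
  rw [IsRoot.def, eval_map] at hz
  rw [aeval_def]
  exact hz

/-- The case of two equal largest exponents. -/
theorem not_common_root_of_eq {a c d e : ℕ} (hc : 0 < c) (hca : c ≤ a)
    (hed : e ≤ d) (hnc : NoUnitRoot a a c) {x : ℝ} (hx0 : 0 < x) (hx1 : x < 1)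
    (hf : x ^ a + x ^ a + x ^ c = 1) (hg : x ^ d + x ^ e = 1) : False := by
  have ha : 0 < a := hc.trans_le hca
  set y := x⁻¹ with hy
  have hy1 : 1 < y := (one_lt_inv₀ hx0).2 hx1
  have hxy : ∀ {i j : ℕ}, j ≤ i → y ^ i * x ^ j = y ^ (i - j) := by
    intro i j hij
    rw [hy, ← Nat.sub_add_cancel hij, pow_add, mul_assoc, ← mul_pow, inv_mul_cancel₀ hx0.ne',
      one_pow, mul_one, Nat.sub_add_cancel hij]
  -- `F` and `G` are the reciprocal polynomials, with `y = 1/x` as root; unlike `2X^a + X^c - 1`,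
  -- `F` is monic.
  set F : ℤ[X] := X ^ a - (X ^ (a - c) + C 2) with hF
  set G : ℤ[X] := X ^ d - (X ^ (d - e) + C 1) with hG
  have hFm : F.Monic := monic_X_pow_sub ((degree_add_le _ _).trans_lt (max_lt (by
    rw [degree_X_pow]; exact_mod_cast Nat.sub_lt ha hc) (degree_C_le.trans_lt (by
    exact_mod_cast ha))))
  have hFy : aeval y F = 0 := by
    have h := congrArg (y ^ a * ·) hf
    simp only [mul_add, hxy le_rfl, hxy hca, Nat.sub_self, pow_zero, mul_one] at h
    simp only [hF, map_sub, map_add, map_pow, aeval_X, aeval_C]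
    rw [← h]
    norm_num
    ring
  have hGy : aeval y G = 0 := by
    have h := congrArg (y ^ d * ·) hg
    simp only [mul_add, hxy le_rfl, hxy hed, Nat.sub_self, pow_zero, mul_one] at h
    simp only [hG, map_sub, map_add, map_pow, aeval_X, aeval_C]
    rw [← h]
    norm_num
    ring
  have hint : IsIntegral ℤ y := ⟨F, hFm, hFy⟩
  obtain ⟨Q, hQ⟩ := minpoly.isIntegrallyClosed_dvd hint hFy
  have hMG := minpoly.isIntegrallyClosed_dvd hint hGy
  have hMm : (minpoly ℤ y).Monic := minpoly.monic hint
  have hQm : Q.Monic := hMm.of_mul_monic_left (hQ ▸ hFm)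
  have hFroot : ∀ z : ℂ, aeval z F = 0 → z ^ a = z ^ (a - c) + 2 := by
    intro z hz
    simp only [hF, map_sub, map_add, map_pow, aeval_X, aeval_C, sub_eq_zero] at hz
    simpa using hz
  have hFnorm : ∀ z : ℂ, aeval z F = 0 → 1 ≤ ‖z‖ := by
    intro z hz
    by_contra! hlt
    have h1 : (2 : ℂ) = z ^ a - z ^ (a - c) := by rw [hFroot z hz]; ring
    have h2 : (2 : ℝ) ≤ ‖z‖ ^ a + ‖z‖ ^ (a - c) := by
      rw [← norm_pow, ← norm_pow]
      refine le_trans ?_ (norm_sub_le _ _)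
      rw [← h1]
      norm_num
    have h3 : ‖z‖ ^ a < 1 := pow_lt_one₀ (norm_nonneg _) hlt ha.ne'
    have h4 : ‖z‖ ^ (a - c) ≤ 1 := pow_le_one₀ (norm_nonneg _) hlt.le
    linarith
  have hMnorm : ∀ z : ℂ, aeval z (minpoly ℤ y) = 0 → 1 ≤ ‖z‖ := fun z hz =>
    hFnorm z (by rw [hQ, map_mul, hz, zero_mul])
  have hQnorm : ∀ z : ℂ, aeval z Q = 0 → 1 ≤ ‖z‖ := fun z hz =>
    hFnorm z (by rw [hQ, map_mul, hz, mul_zero])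
  have hF0 : (minpoly ℤ y).coeff 0 * Q.coeff 0 = F.coeff 0 := by rw [hQ, mul_coeff_zero]
  -- The constant term is `-3` if `a = c` and `-2` otherwise, so the minimal polynomial or its
  -- cofactor `Q` has constant term `±1`.
  have hF0p : Irreducible (F.coeff 0) := by
    rcases hca.eq_or_lt with rfl | hlt
    · have : F.coeff 0 = -3 := by simp [hF, coeff_X_pow, ha.ne]
      rw [this]
      exact (Int.prime_three.neg).irreducible
    · have : F.coeff 0 = -2 := by
        simp [hF, coeff_X_pow, ha.ne, (Nat.sub_pos_of_lt hlt).ne]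
      rw [this]
      exact (Int.prime_two.neg).irreducible
  rcases hF0p.isUnit_or_isUnit hF0.symm with h0 | h0
  · have h := norm_eq_one_of_mem_roots hMm h0 hMnorm (z := (y : ℂ)) (by
      have := minpoly.aeval ℤ y
      rw [← Complex.coe_algebraMap, aeval_algebraMap_apply, this, map_zero])
    rw [Complex.norm_real, Real.norm_of_nonneg (by linarith)] at h
    linarith
  · have hQ1 : Q = 1 := by
      by_contra hne
      obtain ⟨z, hz⟩ := exists_complex_root hQm hne
      have hz1 := norm_eq_one_of_mem_roots hQm h0 hQnorm hz
      have hzF := hFroot z (by rw [hQ, map_mul, hz, mul_zero])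
      have h1 : ‖z ^ a‖ = 1 := by rw [norm_pow, hz1, one_pow]
      have h2 : ‖z ^ (a - c)‖ = 1 := by rw [norm_pow, hz1, one_pow]
      -- Two numbers of modulus `1` that differ by `2` must be `1` and `-1`.
      have h3 : z ^ (a - c) = -1 := by
        have e1 := Complex.sq_norm (z ^ a)
        have e2 := Complex.sq_norm (z ^ (a - c))
        rw [h1, hzF] at e1
        rw [h2] at e2
        simp only [Complex.normSq_apply, Complex.add_re, Complex.add_im, Complex.re_ofNat,
          Complex.im_ofNat, add_zero] at e1 e2
        have e3 : (z ^ (a - c)).re = -1 := by nlinarith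
        have e4 : (z ^ (a - c)).im = 0 := by
          rw [e3] at e2
          nlinarith
        exact Complex.ext (by simpa using e3) (by simpa using e4)
      have h4 : z ^ a = 1 := by rw [hzF, h3]; norm_num
      have h5 : z ^ c = -1 := by
        have : z ^ (a - c) * z ^ c = z ^ a := by rw [← pow_add, Nat.sub_add_cancel hca]
        rw [h3, h4] at this
        linear_combination -this
      exact (hnc z).1 ⟨h4, by rw [h4, h5]; norm_num⟩
    rw [hQ1, mul_one] at hQ
    rw [← hQ] at hMG
    -- `F(1) = -2` does not divide `G(1) = -1`.
    have h := eval_dvd (x := 1) hMG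
    simp [hF, hG] at h

/-! ### Quadrinomials and their mirrors -/

/-- The quadrinomial `X ^ a + X ^ b + X ^ c - 1`. -/
noncomputable def quadrinomial (a b c : ℕ) : ℤ[X] := X ^ a + X ^ b + X ^ c - 1

section quadrinomial

variable {a b c : ℕ}

theorem quadrinomial_coeff (a b c n : ℕ) : (quadrinomial a b c).coeff n =
    (if n = a then 1 else 0) + (if n = b then 1 else 0) + (if n = c then 1 else 0) -
      (if n = 0 then 1 else 0) := by
  simp only [quadrinomial, coeff_sub, coeff_add, coeff_X_pow, coeff_one]

theorem quadrinomial_natDegree (hab : b < a) (hbc : c < b) :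
    (quadrinomial a b c).natDegree = a := by
  refine natDegree_eq_of_le_of_coeff_ne_zero (natDegree_le_iff_coeff_eq_zero.2 fun n hn => ?_) ?_
  · rw [quadrinomial_coeff, if_neg (by omega), if_neg (by omega), if_neg (by omega),
      if_neg (by omega)]
    norm_num
  · rw [quadrinomial_coeff, if_pos rfl, if_neg (by omega), if_neg (by omega), if_neg (by omega)]
    norm_num

theorem quadrinomial_coeff_zero (hab : b < a) (hbc : c < b) (hc : 0 < c) :
    (quadrinomial a b c).coeff 0 = -1 := by
  rw [quadrinomial_coeff, if_neg (by omega), if_neg (by omega), if_neg (by omega), if_pos rfl]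
  norm_num

theorem quadrinomial_monic (hab : b < a) (hbc : c < b) : (quadrinomial a b c).Monic := by
  rw [Monic, leadingCoeff, quadrinomial_natDegree hab hbc, quadrinomial_coeff, if_pos rfl,
    if_neg (by omega), if_neg (by omega), if_neg (by omega)]
  norm_num

theorem quadrinomial_natTrailingDegree (hab : b < a) (hbc : c < b) (hc : 0 < c) :
    (quadrinomial a b c).natTrailingDegree = 0 :=
  natTrailingDegree_eq_zero.2 (Or.inr (by
    rw [quadrinomial_coeff_zero hab hbc hc]; norm_num))

theorem quadrinomial_mirror (hab : b < a) (hbc : c < b) (hc : 0 < c) :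
    (quadrinomial a b c).mirror = 1 + X ^ (a - b) + X ^ (a - c) - X ^ a := by
  rw [mirror, quadrinomial_natTrailingDegree hab hbc hc, pow_zero, mul_one, reverse,
    quadrinomial_natDegree hab hbc, quadrinomial]
  have h1 : reflect a (1 : ℤ[X]) = X ^ a := by simp
  simp only [reflect_sub, reflect_add, reflect_monomial, h1]
  rw [revAt_le le_rfl, revAt_le hab.le, revAt_le (hbc.trans hab).le, Nat.sub_self, pow_zero]

/-- The product is palindromic of degree `2a`, so the coefficients above the middle carry all the
information about the exponents. -/
theorem quadrinomial_mul_mirror_coeff (hab : b < a) (hbc : c < b) (hc : 0 < c) {n : ℕ}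
    (hn : 0 < n) : (quadrinomial a b c * (quadrinomial a b c).mirror).coeff (a + n) =
      (if n = a - b then 1 else 0) + (if n = a - c then 1 else 0) +
        (if n = b - c then 1 else 0) - (if n = a then 1 else 0) - (if n = b then 1 else 0) -
        (if n = c then 1 else 0) := by
  have e : quadrinomial a b c * (quadrinomial a b c).mirror =
      X ^ (a + (a - b)) + X ^ (a + (a - c)) + X ^ (a + (b - c)) - X ^ (a + a) - X ^ (a + b) -
        X ^ (a + c) + (4 * X ^ a + X ^ b + X ^ c + X ^ (a + c - b) - 1 - X ^ (a - b)
          - X ^ (a - c)) := by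
    rw [quadrinomial_mirror hab hbc hc, quadrinomial]
    obtain ⟨i, rfl⟩ := Nat.exists_eq_add_of_lt hbc
    obtain ⟨j, rfl⟩ := Nat.exists_eq_add_of_lt hab
    rw [show c + i + 1 + j + 1 - (c + i + 1) = j + 1 by omega,
      show c + i + 1 + j + 1 - c = i + 1 + (j + 1) by omega,
      show c + i + 1 - c = i + 1 by omega,
      show c + i + 1 + j + 1 + c - (c + i + 1) = c + (j + 1) by omega]
    ring
  have e0 : ∀ k, k ≤ a → ((X : ℤ[X]) ^ k).coeff (a + n) = 0 := fun k hk => by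
    rw [coeff_X_pow, if_neg (by omega)]
  have e1 : ∀ k, ((X : ℤ[X]) ^ (a + k)).coeff (a + n) = if n = k then 1 else 0 := fun k => by
    simp only [coeff_X_pow, add_right_inj]
  have e4 : ((4 : ℤ[X]) * X ^ a).coeff (a + n) = 0 := by
    rw [show (4 : ℤ[X]) = C 4 from rfl, coeff_C_mul, e0 a le_rfl, mul_zero]
  have e5 : (1 : ℤ[X]).coeff (a + n) = 0 := by rw [coeff_one, if_neg (by omega)]
  rw [e]
  simp only [coeff_add, coeff_sub, e1, e4, e5, e0 b hab.le, e0 c (hbc.trans hab).le,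
    e0 (a + c - b) (by omega), e0 (a - b) (Nat.sub_le _ _), e0 (a - c) (Nat.sub_le _ _)]
  ring

/-- Comparing the exponents in `f * f.mirror` for two quadrinomials of the same degree. -/
theorem multiset_eq_of_mul_mirror_eq {p q : ℕ} (hab : b < a) (hbc : c < b) (hc : 0 < c)
    (hqa : q < a) (hpq : p < q) (hp : 0 < p)
    (h : quadrinomial a b c * (quadrinomial a b c).mirror =
      quadrinomial a q p * (quadrinomial a q p).mirror) :
    ({a - b, a - c, b - c, q, p} : Multiset ℕ) = {a - q, a - p, q - p, b, c} := by
  ext n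
  simp only [Multiset.insert_eq_cons, Multiset.count_cons, Multiset.count_singleton]
  rcases Nat.eq_zero_or_pos n with rfl | hn
  · rw [if_neg, if_neg, if_neg, if_neg, if_neg, if_neg, if_neg, if_neg, if_neg, if_neg] <;> omega
  · have h1 := congrArg (fun P => P.coeff (a + n)) h
    beta_reduce at h1
    rw [quadrinomial_mul_mirror_coeff hab hbc hc hn, quadrinomial_mul_mirror_coeff hqa hpq hp hn]
      at h1
    -- The common term at `a` cancels, and moving the negative terms across leaves equal counts.
    apply Nat.cast_injective (R := ℤ)
    push_cast
    linarith

/-- Equal sums and equal sums of squares give a linear relation and a product equal to zero. Its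
second factor leaves one exceptional family, found by locating `b` and `a - p` in the other
multiset; it is genuine, both multisets being `{c, 2c, 4c, 6c, 7c}`. -/
theorem eq_of_multiset_eq_of_le {p q : ℕ} (hab : b < a) (hbc : c < b) (hc : 0 < c)
    (hqa : q < a) (hpq : p < q) (hcp : c ≤ p)
    (h : ({a - b, a - c, b - c, q, p} : Multiset ℕ) = {a - q, a - p, q - p, b, c}) :
    (b = q ∧ c = p) ∨ (a = 8 * c ∧ b = 7 * c ∧ q = 4 * c ∧ p = 2 * c) := by
  have hs := congrArg (fun s : Multiset ℕ => (s.map fun n : ℕ => (n : ℤ)).sum) h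
  have hs2 := congrArg (fun s : Multiset ℕ => (s.map fun n : ℕ => (n : ℤ) ^ 2).sum) h
  simp only [Multiset.insert_eq_cons, Multiset.map_cons, Multiset.map_singleton,
    Multiset.sum_cons, Multiset.sum_singleton] at hs hs2
  rw [Nat.cast_sub hab.le, Nat.cast_sub (hbc.trans hab).le, Nat.cast_sub hbc.le,
    Nat.cast_sub hqa.le, Nat.cast_sub (hpq.trans hqa).le, Nat.cast_sub hpq.le] at hs hs2
  have hlin : (q : ℤ) + 3 * p = b + 3 * c := by linarith
  have hmul : ((p : ℤ) - c) * (a - 2 * (b - c) + 4 * (p - c)) = 0 := by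
    have hq : (q : ℤ) = b + 3 * c - 3 * p := by linarith
    rw [hq] at hs2
    linarith
  rcases mul_eq_zero.1 hmul with h0 | h0
  · left
    omega
  by_cases hpc : p = c
  · left
    omega
  right
  have hb : b ∈ ({a - b, a - c, b - c, q, p} : Multiset ℕ) := by
    rw [h]
    simp
  simp only [Multiset.insert_eq_cons, Multiset.mem_cons, Multiset.mem_singleton] at hb
  have hbac : b = a - c := by omega
  have hap : a - p ∈ ({a - b, a - c, b - c, q, p} : Multiset ℕ) := by
    rw [h]
    simp
  simp only [Multiset.insert_eq_cons, Multiset.mem_cons, Multiset.mem_singleton] at hap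
  omega

/-- The exceptional pair has exponents `(8, 7, 1)` and `(8, 4, 2)` times a common `r`. Any `z` with
`z^r = i` violates `NoUnitRoot` for both members, so neither can be the given quadrinomial. -/
theorem eq_of_mul_mirror_eq {p q : ℕ} (hab : b < a) (hbc : c < b) (hc : 0 < c)
    (hqa : q < a) (hpq : p < q) (hp : 0 < p) (hnc : NoUnitRoot a b c)
    (h : quadrinomial a b c * (quadrinomial a b c).mirror =
      quadrinomial a q p * (quadrinomial a q p).mirror) : b = q ∧ c = p := by
  have hI : ∀ r : ℕ, 0 < r → ∃ z : ℂ, z ^ r = Complex.I := fun r hr =>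
    IsAlgClosed.exists_pow_nat_eq _ hr
  have hI4 : Complex.I ^ 4 = 1 := Complex.I_pow_four
  rcases le_total c p with hcp | hpc
  · rcases eq_of_multiset_eq_of_le hab hbc hc hqa hpq hcp
      (multiset_eq_of_mul_mirror_eq hab hbc hc hqa hpq hp h) with h1 | ⟨rfl, rfl, -, -⟩
    · exact h1
    · obtain ⟨z, hz⟩ := hI c hc
      refine absurd ⟨?_, ?_⟩ (hnc z).1
      · rw [mul_comm, pow_mul, hz]
        linear_combination (Complex.I ^ 4 + 1) * hI4
      · rw [mul_comm, pow_mul, hz]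
        linear_combination Complex.I ^ 3 * hI4 + Complex.I * Complex.I_sq
  · rcases eq_of_multiset_eq_of_le hqa hpq hp hab hbc hpc
      (multiset_eq_of_mul_mirror_eq hqa hpq hp hab hbc hc h.symm) with h1 | ⟨rfl, -, rfl, rfl⟩
    · exact ⟨h1.1.symm, h1.2.symm⟩
    · obtain ⟨z, hz⟩ := hI p hp
      refine absurd ⟨?_, ?_⟩ (hnc z).1
      · rw [mul_comm, pow_mul, hz]
        linear_combination (Complex.I ^ 4 + 1) * hI4
      · rw [mul_comm, pow_mul, mul_comm, pow_mul, hz]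
        linear_combination hI4 + Complex.I_sq

end quadrinomial

/-- The hypotheses say exactly that `(1 - u)(1 - v)(1 - w)` vanishes while the sum is `1`. With `u,
v, w = z^a, z^b, z^c` they describe a common root of a quadrinomial and its mirror. -/
theorem mul_eq_zero_of_sum_eq_one {u v w : ℂ} (h1 : u + v + w = 1)
    (h2 : v * w + u * w + u * v - u * v * w = 0) :
    (u = 1 ∧ v + w = 0) ∨ (v = 1 ∧ u + w = 0) ∨ (w = 1 ∧ u + v = 0) := by
  have h : (1 - u) * ((1 - v) * (1 - w)) = 0 := by linear_combination h2 - h1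
  rcases mul_eq_zero.1 h with h | h
  · exact Or.inl ⟨by linear_combination -h, by linear_combination h1 + h⟩
  rcases mul_eq_zero.1 h with h | h
  · exact Or.inr (Or.inl ⟨by linear_combination -h, by linear_combination h1 + h⟩)
  · exact Or.inr (Or.inr ⟨by linear_combination -h, by linear_combination h1 + h⟩)

/-! ### Irreducibility by Ljunggren's method -/

section quadrinomial

variable {a b c : ℕ}

theorem quadrinomial_isRelPrime_mirror (hab : b < a) (hbc : c < b) (hc : 0 < c)
    (hnc : NoUnitRoot a b c) :
    IsRelPrime (quadrinomial a b c) (quadrinomial a b c).mirror := by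
  intro D hD1 hD2
  by_cases hdeg : D.natDegree = 0
  · rw [eq_C_of_natDegree_eq_zero hdeg] at hD1 ⊢
    have h := (C_dvd_iff_dvd_coeff _ _).1 hD1 0
    rw [quadrinomial_coeff_zero hab hbc hc] at h
    exact (isUnit_of_dvd_unit h (by simp)).map C
  · exfalso
    obtain ⟨z, hz⟩ := IsAlgClosed.exists_root (D.map (Int.castRingHom ℂ)) (by
      rw [Polynomial.degree_map_eq_of_injective (RingHom.injective_int _)]
      exact fun h => hdeg (natDegree_eq_of_degree_eq_some h))
    have hzD : aeval z D = 0 := by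
      rw [IsRoot.def, eval_map] at hz
      exact hz
    have h1 : aeval z (quadrinomial a b c) = 0 := aeval_eq_zero_of_dvd_aeval_eq_zero hD1 hzD
    have h2 := aeval_eq_zero_of_dvd_aeval_eq_zero hD2 hzD
    rw [quadrinomial_mirror hab hbc hc] at h2
    simp only [quadrinomial, map_sub, map_add, map_pow, aeval_X, map_one] at h1 h2
    have hb : z ^ (a - b) * z ^ b = z ^ a := by rw [← pow_add, Nat.sub_add_cancel hab.le]
    have hc' : z ^ (a - c) * z ^ c = z ^ a := by
      rw [← pow_add, Nat.sub_add_cancel (hbc.trans hab).le]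
    rcases mul_eq_zero_of_sum_eq_one (sub_eq_zero.1 h1) (by
      linear_combination z ^ b * z ^ c * h2 - z ^ c * hb - z ^ b * hc') with h | h | h
    · exact (hnc z).1 h
    · exact (hnc z).2.1 h
    · exact (hnc z).2.2 h

theorem quadrinomial_eval_one (a b c : ℕ) : (quadrinomial a b c).eval 1 = 2 := by
  simp [quadrinomial]

theorem quadrinomial_sum_sq (hab : b < a) (hbc : c < b) (hc : 0 < c) :
    (quadrinomial a b c).sum (fun _ x => x ^ 2) = 4 := by
  have hdeg := quadrinomial_natDegree hab hbc
  rw [sum_over_range _ (by simp), hdeg]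
  have h1 := quadrinomial_eval_one a b c
  rw [eval_eq_sum_range, hdeg] at h1
  -- All coefficients are `0` or `1` except the constant term `-1`, where the square exceeds the
  -- coefficient by `2`.
  have h2 : ∀ n, (quadrinomial a b c).coeff n ^ 2 =
      (quadrinomial a b c).coeff n * 1 ^ n + if n = 0 then 2 else 0 := by
    intro n
    rw [quadrinomial_coeff]
    split_ifs <;> first | omega | norm_num
  simp only [h2]
  rw [Finset.sum_add_distrib, h1]
  simp

/-- An integer polynomial of value `2` at `1` whose squared coefficients sum to `4` and whose
extreme coefficients have product `-1` is a quadrinomial or the mirror of one. -/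
theorem exists_eq_quadrinomial {k : ℤ[X]} (hk : k.natDegree = a) (ha : 0 < a)
    (hprod : k.coeff 0 * k.coeff a = -1) (hsq : k.sum (fun _ x => x ^ 2) = 4)
    (h1 : k.eval 1 = 2) : ∃ p q : ℕ, 0 < p ∧ p < q ∧ q < a ∧
      (k = quadrinomial a q p ∨ k = (quadrinomial a q p).mirror) := by
  rw [sum_over_range _ (by simp), hk] at hsq
  rw [eval_eq_sum_range, hk] at h1
  have hsplit : ∀ g : ℕ → ℤ, ∑ n ∈ Finset.range (a + 1), g n =
      g 0 + g a + ∑ n ∈ Finset.Ioo 0 a, g n := by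
    intro g
    rw [Finset.sum_range_succ, Finset.range_eq_Ico, ← Finset.Ioo_insert_left ha,
      Finset.sum_insert (by simp)]
    ring
  rw [hsplit] at hsq h1
  have huw : (k.coeff 0 = 1 ∧ k.coeff a = -1) ∨ (k.coeff 0 = -1 ∧ k.coeff a = 1) := by
    rcases Int.mul_eq_neg_one_iff_eq_one_or_neg_one.1 hprod with h | h
    · exact Or.inl h
    · exact Or.inr h
  simp only [one_pow, mul_one] at h1
  have h1' : ∑ n ∈ Finset.Ioo 0 a, k.coeff n = 2 := by
    rcases huw with ⟨h, h'⟩ | ⟨h, h'⟩ <;> rw [h, h'] at h1 <;> linarith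
  have hsq' : ∑ n ∈ Finset.Ioo 0 a, k.coeff n ^ 2 = 2 := by
    rcases huw with ⟨h, h'⟩ | ⟨h, h'⟩ <;> rw [h, h'] at hsq <;> linarith
  -- The inner coefficients and their squares both sum to `2`; since `z^2 - z ≥ 0` on the integers,
  -- each is `0` or `1`, and exactly two are `1`.
  have hnonneg : ∀ z : ℤ, 0 ≤ z ^ 2 - z := by
    intro z
    rcases le_or_gt z 0 with h | h <;> nlinarith
  have hcoeff : ∀ n ∈ Finset.Ioo 0 a, k.coeff n = 0 ∨ k.coeff n = 1 := by
    have h0 : ∑ n ∈ Finset.Ioo 0 a, (k.coeff n ^ 2 - k.coeff n) = 0 := by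
      rw [Finset.sum_sub_distrib, h1', hsq', sub_self]
    intro n hn
    have h2 := (Finset.sum_eq_zero_iff_of_nonneg fun n _ => hnonneg (k.coeff n)).1 h0 n hn
    have h3 : k.coeff n * (k.coeff n - 1) = 0 := by linarith
    rcases mul_eq_zero.1 h3 with h | h
    · exact Or.inl h
    · exact Or.inr (by linarith)
  set T := (Finset.Ioo 0 a).filter fun n => k.coeff n = 1 with hT
  have hcard : T.card = 2 := by
    have h : ∑ n ∈ Finset.Ioo 0 a, k.coeff n =
        ∑ n ∈ Finset.Ioo 0 a, if k.coeff n = 1 then 1 else 0 := by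
      refine Finset.sum_congr rfl fun n hn => ?_
      rcases hcoeff n hn with h | h <;> simp [h]
    rw [h, Finset.sum_boole, ← hT] at h1'
    exact_mod_cast h1'
  obtain ⟨p, q, hpq, hTpq⟩ : ∃ p q, p < q ∧ T = {p, q} := by
    obtain ⟨p, q, hne, h⟩ := Finset.card_eq_two.1 hcard
    rcases lt_or_gt_of_ne hne with hlt | hlt
    · exact ⟨p, q, hlt, h⟩
    · exact ⟨q, p, hlt, by rw [h, Finset.pair_comm]⟩
  have hmem : ∀ n, n ∈ T ↔ n = p ∨ n = q := by simp [hTpq]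
  have hp := Finset.mem_Ioo.1 (Finset.mem_filter.1 ((hmem p).2 (Or.inl rfl))).1
  have hq := Finset.mem_Ioo.1 (Finset.mem_filter.1 ((hmem q).2 (Or.inr rfl))).1
  have hform : k = C (k.coeff 0) + C (k.coeff a) * X ^ a + X ^ p + X ^ q := by
    ext n
    simp only [coeff_add, coeff_C, coeff_C_mul, coeff_X_pow]
    rcases lt_or_ge a n with han | han
    · rw [coeff_eq_zero_of_natDegree_lt (by omega)]
      simp [show n ≠ 0 by omega, show n ≠ a by omega, show n ≠ p by omega, show n ≠ q by omega]
    by_cases hn0 : n = 0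
    · subst hn0
      simp [ha.ne, hp.1.ne, hq.1.ne]
    by_cases hna : n = a
    · subst hna
      simp [ha.ne', hp.2.ne', hq.2.ne']
    have hn : n ∈ Finset.Ioo 0 a := Finset.mem_Ioo.2 (by omega)
    rcases hcoeff n hn with h | h
    · have hnT : ¬ (n = p ∨ n = q) := by
        rw [← hmem, hT, Finset.mem_filter, h]
        simp
      rw [not_or] at hnT
      simp [h, hn0, hna, hnT.1, hnT.2]
    · rcases (hmem n).1 (Finset.mem_filter.2 ⟨hn, h⟩) with rfl | rfl
      · simp [h, hn0, hna, hpq.ne]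
      · simp [h, hn0, hna, hpq.ne']
  rcases huw with ⟨h, h'⟩ | ⟨h, h'⟩
  · refine ⟨a - q, a - p, by omega, by omega, by omega, Or.inr ?_⟩
    rw [quadrinomial_mirror (by omega) (by omega) (by omega), hform, h, h',
      show a - (a - p) = p by omega, show a - (a - q) = q by omega]
    simp only [map_neg, map_one]
    ring
  · refine ⟨p, q, hp.1, hpq, hq.2, Or.inl ?_⟩
    rw [quadrinomial, hform, h, h']
    simp only [map_neg, map_one]
    ring

/-- A quadrinomial without roots on the unit circle is irreducible. -/
theorem quadrinomial_irreducible (hab : b < a) (hbc : c < b) (hc : 0 < c)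
    (hnc : NoUnitRoot a b c) : Irreducible (quadrinomial a b c) := by
  have ha : 0 < a := by omega
  set f := quadrinomial a b c with hf
  have hfdeg : f.natDegree = a := quadrinomial_natDegree hab hbc
  have hftr : f.natTrailingDegree = 0 := quadrinomial_natTrailingDegree hab hbc hc
  have hf0 : f.coeff 0 = -1 := quadrinomial_coeff_zero hab hbc hc
  have hfm : f.Monic := quadrinomial_monic hab hbc
  refine irreducible_of_mirror ?_ ?_ (quadrinomial_isRelPrime_mirror hab hbc hc hnc)
  · intro hu
    have := natDegree_eq_zero_of_isUnit hu
    omega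
  intro k hk
  have hkdeg : k.natDegree = a := by
    have h := congrArg natDegree hk
    rw [natDegree_mul_mirror, natDegree_mul_mirror] at h
    omega
  have hktr : k.natTrailingDegree = 0 := by
    have h := congrArg natTrailingDegree hk
    rw [natTrailingDegree_mul_mirror, natTrailingDegree_mul_mirror] at h
    omega
  have hprod : k.coeff 0 * k.coeff a = -1 := by
    have h := congrArg leadingCoeff hk
    rw [leadingCoeff_mul, leadingCoeff_mul, mirror_leadingCoeff, mirror_leadingCoeff,
      trailingCoeff, trailingCoeff, hftr, hktr, hfm.leadingCoeff, hf0, leadingCoeff, hkdeg] at h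
    linarith
  -- The sum of squared coefficients is the middle coefficient of `k * k.mirror`, hence shared with
  -- `f`.
  have hsq : k.sum (fun _ x => x ^ 2) = 4 := by
    have h := coeff_mul_mirror f
    rw [hk, hfdeg, hftr, ← hkdeg, ← hktr, coeff_mul_mirror] at h
    rw [h]
    exact quadrinomial_sum_sq hab hbc hc
  have heval : k.eval 1 = 2 ∨ k.eval 1 = -2 := by
    have h := congrArg (eval 1) hk
    rw [eval_mul, eval_mul, mirror_eval_one, mirror_eval_one, hf, quadrinomial_eval_one] at h
    have h2 : (k.eval 1 - 2) * (k.eval 1 + 2) = 0 := by linarith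
    rcases mul_eq_zero.1 h2 with h | h
    · exact Or.inl (by linarith)
    · exact Or.inr (by linarith)
  have key : ∀ l : ℤ[X], f * f.mirror = l * l.mirror → (∃ p q : ℕ, 0 < p ∧ p < q ∧ q < a ∧
      (l = quadrinomial a q p ∨ l = (quadrinomial a q p).mirror)) → l = f ∨ l = f.mirror := by
    rintro l hl ⟨p, q, hp, hpq, hqa, rfl | rfl⟩
    · obtain ⟨rfl, rfl⟩ := eq_of_mul_mirror_eq hab hbc hc hqa hpq hp hnc hl
      exact Or.inl rfl
    · rw [mirror_mirror, mul_comm (quadrinomial a q p).mirror] at hl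
      obtain ⟨rfl, rfl⟩ := eq_of_mul_mirror_eq hab hbc hc hqa hpq hp hnc hl
      exact Or.inr rfl
  rcases heval with h | h
  · rcases key k hk (exists_eq_quadrinomial hkdeg ha hprod hsq h) with h | h
    · exact Or.inl h
    · exact Or.inr (Or.inr (Or.inl h))
  -- If `k(1) = -2`, the classification applies to `-k`.
  · have hsq' : (-k).sum (fun _ x => x ^ 2) = 4 := by
      rw [sum_over_range _ (by simp)] at hsq ⊢
      simpa using hsq
    rcases key (-k) (by rw [mirror_neg, neg_mul_neg, hk]) (exists_eq_quadrinomial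
      (by rw [natDegree_neg, hkdeg]) ha (by rw [coeff_neg, coeff_neg, neg_mul_neg, hprod]) hsq'
      (by rw [eval_neg, h, neg_neg])) with h | h
    · exact Or.inr (Or.inl (neg_eq_iff_eq_neg.1 h))
    · exact Or.inr (Or.inr (Or.inr (neg_eq_iff_eq_neg.1 h)))

end quadrinomial

/-! ### No common root, and the conclusion -/

/-- The case of three distinct exponents. -/
theorem not_common_root_of_lt {a b c d e : ℕ} (hab : b < a) (hbc : c < b) (hc : 0 < c)
    (hnc : NoUnitRoot a b c) {x : ℝ}
    (hf : x ^ a + x ^ b + x ^ c = 1) (hg : x ^ d + x ^ e = 1) : False := by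
  have hfx : aeval x (quadrinomial a b c) = 0 := by simp [quadrinomial, hf]
  have hgx : aeval x (X ^ d + X ^ e - 1 : ℤ[X]) = 0 := by simp [hg]
  have hint : IsIntegral ℤ x := ⟨_, quadrinomial_monic hab hbc, hfx⟩
  obtain ⟨Q, hQ⟩ := minpoly.isIntegrallyClosed_dvd hint hfx
  have hQu : IsUnit Q := ((quadrinomial_irreducible hab hbc hc hnc).isUnit_or_isUnit
    hQ).resolve_left (minpoly.not_isUnit ℤ x)
  have hdvd : quadrinomial a b c ∣ X ^ d + X ^ e - 1 := by
    rw [hQ, hQu.mul_right_dvd]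
    exact minpoly.isIntegrallyClosed_dvd hint hgx
  -- At `1` the divisibility reads `2 ∣ 1`.
  have h := eval_dvd (x := 1) hdvd
  rw [quadrinomial_eval_one] at h
  simp at h

theorem not_common_root_of_le {a b c d e : ℕ} (hc : 0 < c) (hcb : c ≤ b) (hba : b ≤ a)
    (hbc : b = c → a ≤ b) (hnc : NoUnitRoot a b c) {x : ℝ} (hx0 : 0 < x) (hx1 : x < 1)
    (hf : x ^ a + x ^ b + x ^ c = 1) (hg : x ^ d + x ^ e = 1) : False := by
  wlog hed : e ≤ d generalizing d e
  · exact this (by rw [add_comm, hg]) (le_of_not_ge hed)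
  rcases hba.eq_or_lt with rfl | hba
  · exact not_common_root_of_eq hc hcb hed hnc hx0 hx1 hf hg
  rcases hcb.eq_or_lt with rfl | hcb
  · exact absurd (hbc rfl) (not_le.2 hba)
  · exact not_common_root_of_lt hba hcb hc hnc hf hg

/-- The trinomial equation and the binomial equation have no common root in `(0, 1)`. -/
theorem not_common_root {a b c d e : ℕ} (ha : 0 < a) (hb : 0 < b) (hc : 0 < c)
    (hab : a = b → c ≤ a) (hac : a = c → b ≤ a) (hbc : b = c → a ≤ b)
    (hnc : NoUnitRoot a b c) {x : ℝ} (hx0 : 0 < x) (hx1 : x < 1)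
    (hf : x ^ a + x ^ b + x ^ c = 1) (hg : x ^ d + x ^ e = 1) : False := by
  wlog hba : b ≤ a generalizing a b
  · exact this (a := b) (b := a) hb ha (by omega) (by omega) (by omega) hnc.swap_left
      (by rw [← hf]; ring) (by omega)
  rcases le_total c b with h | h
  · exact not_common_root_of_le hc h hba hbc hnc hx0 hx1 hf hg
  rcases le_total c a with h' | h'
  · exact not_common_root_of_le hb h h' (by omega) hnc.swap_right hx0 hx1
      (by rw [← hf]; ring) hg
  · exact not_common_root_of_le hb hba h' (by omega) hnc.swap_right.swap_left hx0 hx1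
      (by rw [← hf]; ring) hg

end Polynomial

theorem mainTheorem4 (N : ℕ) (lam : ℝ) (hlam0 : 0 < lam) (hlam1 : lam < 1)
    (a b c d e : ℕ) (ha : 0 < a) (hb : 0 < b) (hc : 0 < c) (hd : 0 < d) (he : 0 < e)
    (hab : a = b → c ≤ a) (hac : a = c → b ≤ a) (hbc : b = c → a ≤ b)
    (hα : IsContractionVector N ![lam ^ a, lam ^ b, lam ^ c])
    (hβ : IsContractionVector N ![lam ^ d, lam ^ e])
    (hcond : (Odd a ∧ Odd b ∧ Odd c) ∨ ArithmeticCondition a b c) :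
    ¬ DustEquivalent N ![lam ^ a, lam ^ b, lam ^ c] ![lam ^ d, lam ^ e] := by
  rintro ⟨E, hE, F, hF, hEF⟩
  have hnc : NoUnitRoot a b c := by
    rcases hcond with ⟨h1, h2, h3⟩ | h
    · exact noUnitRoot_of_odd h1 h2 h3
    · exact noUnitRoot_of_arithmeticCondition ha hb hc h
  have hp : ∀ i, 0 < (![a, b, c] : Fin 3 → ℕ) i := by
    intro i
    fin_cases i <;> assumption
  have hq : ∀ i, 0 < (![d, e] : Fin 2 → ℕ) i := by
    intro i
    fin_cases i <;> assumption
  have hα' : ![lam ^ a, lam ^ b, lam ^ c] = fun i => lam ^ (![a, b, c] : Fin 3 → ℕ) i := by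
    funext i
    fin_cases i <;> rfl
  have hβ' : ![lam ^ d, lam ^ e] = fun i => lam ^ (![d, e] : Fin 2 → ℕ) i := by
    funext i
    fin_cases i <;> rfl
  rw [hα'] at hE
  rw [hβ'] at hF
  obtain ⟨x, hx0, hx1, hx⟩ := exists_root_sum_pow (by norm_num) hp
  obtain ⟨y, hy0, hy1, hy⟩ := exists_root_sum_pow le_rfl hq
  obtain rfl := root_eq_of_lipschitzEquivalent hlam0 hlam1 hp hq hE hF hEF hx0 hx1 hx hy0 hy1 hy
  exact not_common_root ha hb hc hab hac hbc hnc hx0 hx1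
    (by simpa [Fin.sum_univ_three] using hx) (by simpa [Fin.sum_univ_two] using hy)
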